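/- Let $k,m\ge 1$ be integers. Write $M_n$ for the algebra of complex $n\times n$ matrices and identify $M_m\otimes M_k$ with $M_{mk}$ via the Kronecker product. A linear map between matrix algebras is called positive if it sends positive semidefinite Hermitian matrices to positive semidefinite Hermitian matrices. A positive map $S:M_p\to M_q$ is doubly stochastic if $S\left(\frac{\mathrm{Id}}{\sqrt p}\right)=\frac{\mathrm{Id}}{\sqrt q}$ and $S^*\left(\frac{\mathrm{Id}}{\sqrt q}\right)=\frac{\mathrm{Id}}{\sqrt p}$, where $S^*$ is the adjoint of $S$ with respect to the trace inner product $\langle A,B\rangle=\mathrm{tr}(AB^*)$. Linear maps $S,S_1:M_p\to M_q$ are equivalent if there are invertible matrices $X'\in M_p$, $Y'\in M_q$ such that $S_1(X)=Y'S(X'XX'^*)Y'^*$ for every $X\in M_p$. Let $\{e_1,\dots,e_m\}$ be the canonical basis of $\mathbb{C}^m$ and let $T:M_k\to M_m$ be a positive linear map. Define $\widetilde T:M_m\otimes M_k\to M_m\otimes M_k$ by $$\widetilde T\left(\sum_{i,j=1}^m e_ie_j^t\otimes B_{ij}\right)=T\left(\sum_{i=1}^m B_{ii}\right)\otimes \mathrm{Id}_{k\times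 k},\qquad B_{ij}\in M_k.$$ Then $T:M_k\to M_m$ is equivalent to a doubly stochastic map if and only if $\widetilde T:M_m\otimes M_k\to M_m\otimes M_k$ is equivalent to a doubly stochastic map. -/

import Mathlib

open scoped Kronecker ComplexOrder

namespace PositiveMap

variable {ι κ : Type*} [DecidableEq ι] [Fintype κ] [DecidableEq κ]

/-- The square map `T̃ : M_m ⊗ M_k → M_m ⊗ M_k` of `T : M_k → M_m`, with `M_m ⊗ M_k` identified
with the matrices indexed by pairs through the Kronecker product: if `B i j` is the `(i, j)` block
of `Z`, that is `Z = ∑ i j, e_i e_jᵗ ⊗ B i j`, then `T̃ Z = T (∑ i, B i i) ⊗ Id`. -/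
noncomputable def squareMap (T : Matrix ι ι ℂ →ₗ[ℂ] Matrix κ κ ℂ) :
    Matrix (κ × ι) (κ × ι) ℂ →ₗ[ℂ] Matrix (κ × ι) (κ × ι) ℂ where
  toFun Z := T (∑ i : κ, Z.submatrix (Prod.mk i) (Prod.mk i)) ⊗ₖ (1 : Matrix ι ι ℂ)
  map_add' Z W := by
    simp [Matrix.submatrix_add, Finset.sum_add_distrib, Matrix.add_kronecker]
  map_smul' c Z := by
    simp [Matrix.submatrix_smul, ← Finset.smul_sum, Matrix.smul_kronecker]

/-- The defining formula of `T̃` on block matrices. -/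
theorem squareMap_sum (T : Matrix ι ι ℂ →ₗ[ℂ] Matrix κ κ ℂ) (B : κ → κ → Matrix ι ι ℂ) :
    squareMap T (∑ i : κ, ∑ j : κ, Matrix.single i j (1 : ℂ) ⊗ₖ B i j) =
      T (∑ i : κ, B i i) ⊗ₖ (1 : Matrix ι ι ℂ) := by
  have h : ∀ l : κ, (∑ i : κ, ∑ j : κ, Matrix.single i j (1 : ℂ) ⊗ₖ B i j).submatrix
      (Prod.mk l) (Prod.mk l) = B l l := by
    intro l
    ext a b
    simp [Matrix.sum_apply, Matrix.single_apply, ite_and]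
  simp only [squareMap, LinearMap.coe_mk, AddHom.coe_mk, h]

variable [Fintype ι]

/-- A linear map between complex matrix algebras is positive if it sends positive semidefinite
Hermitian matrices to positive semidefinite Hermitian matrices. -/
def IsPositive (T : Matrix ι ι ℂ →ₗ[ℂ] Matrix κ κ ℂ) : Prop :=
  ∀ X : Matrix ι ι ℂ, X.PosSemidef → (T X).PosSemidef

/-- The adjoint of `T` for the trace inner product `⟨A, B⟩ = tr (A * Bᴴ)`; see
`trace_mul_adjoint` and `adjoint_unique` below. -/
noncomputable def adjoint (T : Matrix ι ι ℂ →ₗ[ℂ] Matrix κ κ ℂ) :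
    Matrix κ κ ℂ →ₗ[ℂ] Matrix ι ι ℂ where
  toFun Y := Matrix.of fun a b => ((T (Matrix.single a b 1)).conjTranspose * Y).trace
  map_add' Y Z := by
    ext a b
    simp [Matrix.mul_add]
  map_smul' c Y := by
    ext a b
    simp

/-- `⟨T X, Y⟩ = ⟨X, T* Y⟩`. -/
theorem trace_mul_adjoint (T : Matrix ι ι ℂ →ₗ[ℂ] Matrix κ κ ℂ) (X : Matrix ι ι ℂ)
    (Y : Matrix κ κ ℂ) :
    (T X * Y.conjTranspose).trace = (X * (adjoint T Y).conjTranspose).trace := by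
  have hX : T X = ∑ a : ι, ∑ b : ι, X a b • T (Matrix.single a b 1) := by
    conv_lhs => rw [Matrix.matrix_eq_sum_single X]
    simp only [map_sum]
    refine Finset.sum_congr rfl fun a _ => Finset.sum_congr rfl fun b _ => ?_
    rw [← map_smul, Matrix.smul_single, smul_eq_mul, mul_one]
  have hA : ∀ a b : ι, star (adjoint T Y a b) =
      (T (Matrix.single a b 1) * Y.conjTranspose).trace := by
    intro a b
    simp only [adjoint, LinearMap.coe_mk, AddHom.coe_mk, Matrix.of_apply]
    rw [← Matrix.trace_conjTranspose, Matrix.conjTranspose_mul, Matrix.conjTranspose_conjTranspose,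
      Matrix.trace_mul_comm]
  rw [hX]
  simp only [Finset.sum_mul, Matrix.trace_sum, Matrix.smul_mul, Matrix.trace_smul, smul_eq_mul,
    ← hA]
  simp [Matrix.trace, Matrix.mul_apply]

/-- The identity `⟨T X, Y⟩ = ⟨X, S Y⟩` determines `S`. -/
theorem adjoint_unique (T : Matrix ι ι ℂ →ₗ[ℂ] Matrix κ κ ℂ)
    (S : Matrix κ κ ℂ →ₗ[ℂ] Matrix ι ι ℂ)
    (h : ∀ X Y, (T X * Y.conjTranspose).trace = (X * (S Y).conjTranspose).trace) :
    S = adjoint T := by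
  ext1 Y
  have h1 : ∀ X : Matrix ι ι ℂ,
      (X * (S Y - adjoint T Y).conjTranspose).trace = 0 := by
    intro X
    rw [Matrix.conjTranspose_sub, Matrix.mul_sub, Matrix.trace_sub, ← h, ← trace_mul_adjoint,
      sub_self]
  exact sub_eq_zero.mp (Matrix.trace_mul_conjTranspose_self_eq_zero_iff.mp (h1 _))

/-- `T` is doubly stochastic if it is positive, `T (Id / √k) = Id / √m` and
`T* (Id / √m) = Id / √k`, where `k`, `m` are the orders of the matrices in the source and in the
target. -/
def IsDoublyStochastic (T : Matrix ι ι ℂ →ₗ[ℂ] Matrix κ κ ℂ) : Prop :=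
  IsPositive T ∧
    T (((√(Fintype.card ι : ℝ) : ℝ) : ℂ)⁻¹ • (1 : Matrix ι ι ℂ)) =
      ((√(Fintype.card κ : ℝ) : ℝ) : ℂ)⁻¹ • (1 : Matrix κ κ ℂ) ∧
    adjoint T (((√(Fintype.card κ : ℝ) : ℝ) : ℂ)⁻¹ • (1 : Matrix κ κ ℂ)) =
      ((√(Fintype.card ι : ℝ) : ℝ) : ℂ)⁻¹ • (1 : Matrix ι ι ℂ)

/-- `T` and `T₁` are equivalent if `T₁ X = Y' * T (X' * X * X'ᴴ) * Y'ᴴ` for some invertible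
matrices `X'`, `Y'`. -/
def Equivalent (T T₁ : Matrix ι ι ℂ →ₗ[ℂ] Matrix κ κ ℂ) : Prop :=
  ∃ (X' : Matrix ι ι ℂ) (Y' : Matrix κ κ ℂ), IsUnit X' ∧ IsUnit Y' ∧
    ∀ X : Matrix ι ι ℂ, T₁ X = Y' * T (X' * X * X'.conjTranspose) * Y'.conjTranspose

/-- `T` is equivalent to some doubly stochastic map. -/
def IsEquivalentToDoublyStochastic (T : Matrix ι ι ℂ →ₗ[ℂ] Matrix κ κ ℂ) : Prop :=
  ∃ S : Matrix ι ι ℂ →ₗ[ℂ] Matrix κ κ ℂ, IsDoublyStochastic S ∧ Equivalent T S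

end PositiveMap

namespace PositiveMap

/-! Being equivalent to a doubly stochastic map amounts to solving scaling equations in positive
definite matrices, `T P = Q⁻¹` and `T* Q = (m/k) P⁻¹` (`isEquivalentToDoublyStochastic_iff`), with
`P = X' X'ᴴ` and `Q` a multiple of `Y'ᴴ Y'`. For `T̃` the ratio is 1. Since `T̃` and its adjoint see
only partial traces and output `A ⊗ 1` and `1 ⊗ B` (`adjoint_squareMap`), a solution for `T` gives
one for `T̃` by tensoring with identities. Conversely, comparing diagonal compressions in the
equations for `T̃` yields a solution for `T`. -/

theorem IsPositive.squareMap {ι κ : Type*} [Fintype ι] [DecidableEq ι] [Fintype κ]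
    {T : Matrix ι ι ℂ →ₗ[ℂ] Matrix κ κ ℂ} (hT : IsPositive T) :
    IsPositive (squareMap T) := by
  intro Z hZ
  exact (hT _ (Matrix.posSemidef_sum _ fun i _ => hZ.submatrix _)).kronecker Matrix.PosSemidef.one

/-- `A ⊗ 1` never mixes different second indices, so its product with `W` can be compressed to one
such index at a time. -/
theorem submatrix_kronecker_one_mul {ι κ : Type*} [Fintype ι] [DecidableEq ι] [Fintype κ]
    (A : Matrix κ κ ℂ) (W : Matrix (κ × ι) (κ × ι) ℂ) (a : ι) :
    ((A ⊗ₖ (1 : Matrix ι ι ℂ)) * W).submatrix (fun i => (i, a)) (fun i => (i, a)) =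
      A * W.submatrix (fun i => (i, a)) (fun i => (i, a)) := by
  ext i j
  simp [Matrix.mul_apply, Fintype.sum_prod_type, Matrix.one_apply]

theorem submatrix_one_kronecker_mul {ι κ : Type*} [Fintype ι] [Fintype κ] [DecidableEq κ]
    (B : Matrix ι ι ℂ) (W : Matrix (κ × ι) (κ × ι) ℂ) (i : κ) :
    (((1 : Matrix κ κ ℂ) ⊗ₖ B) * W).submatrix (Prod.mk i) (Prod.mk i) =
      B * W.submatrix (Prod.mk i) (Prod.mk i) := by
  ext a b
  simp only [Matrix.submatrix_apply, Matrix.mul_apply, Fintype.sum_prod_type,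
    Matrix.kronecker_apply]
  rw [Finset.sum_eq_single i (by intro j _ hj; simp [hj.symm]) (by simp)]
  simp

section

variable {ι κ : Type*} [Fintype ι] [DecidableEq ι] [Fintype κ] [DecidableEq κ]

theorem adjoint_apply_eq_of_trace (T : Matrix ι ι ℂ →ₗ[ℂ] Matrix κ κ ℂ) {W : Matrix κ κ ℂ}
    {V : Matrix ι ι ℂ} (h : ∀ X, (T X * W.conjTranspose).trace = (X * V.conjTranspose).trace) :
    adjoint T W = V := by
  have h1 : ∀ X : Matrix ι ι ℂ, (X * (V - adjoint T W).conjTranspose).trace = 0 := by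
    intro X
    rw [Matrix.conjTranspose_sub, Matrix.mul_sub, Matrix.trace_sub, ← h, ← trace_mul_adjoint,
      sub_self]
  exact (sub_eq_zero.mp (Matrix.trace_mul_conjTranspose_self_eq_zero_iff.mp (h1 _))).symm

/-- Conjugations move across the trace pairing by cyclicity. -/
theorem adjoint_conj {S T : Matrix ι ι ℂ →ₗ[ℂ] Matrix κ κ ℂ} {X' : Matrix ι ι ℂ}
    {Y' : Matrix κ κ ℂ}
    (h : ∀ X, S X = Y' * T (X' * X * X'.conjTranspose) * Y'.conjTranspose) (W : Matrix κ κ ℂ) :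
    adjoint S W = X'.conjTranspose * adjoint T (Y'.conjTranspose * W * Y') * X' := by
  refine adjoint_apply_eq_of_trace S fun X => ?_
  have h1 := trace_mul_adjoint T (X' * X * X'.conjTranspose) (Y'.conjTranspose * W * Y')
  calc (S X * W.conjTranspose).trace
      = (T (X' * X * X'.conjTranspose) * (Y'.conjTranspose * W * Y').conjTranspose).trace := by
        rw [h, Matrix.mul_assoc, Matrix.mul_assoc, Matrix.trace_mul_comm]
        simp [Matrix.conjTranspose_mul, Matrix.mul_assoc]
    _ = _ := by
        rw [h1, Matrix.mul_assoc, Matrix.mul_assoc, Matrix.trace_mul_comm]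
        simp [Matrix.conjTranspose_mul, Matrix.mul_assoc]

open scoped MatrixOrder in
theorem exists_isUnit_mul_conjTranspose {P : Matrix ι ι ℂ} (hP : P.PosDef) :
    ∃ X : Matrix ι ι ℂ, IsUnit X ∧ P = X * X.conjTranspose := by
  obtain ⟨B, rfl⟩ := CStarAlgebra.nonneg_iff_eq_star_mul_self.mp hP.posSemidef.nonneg
  exact ⟨B.conjTranspose, isUnit_of_mul_isUnit_left hP.isUnit,
    by simp [Matrix.star_eq_conjTranspose]⟩

/-- `T` can be scaled to a doubly stochastic map exactly when the scaling equations
`T P = Q⁻¹` and `T* Q = (|κ| / |ι|) P⁻¹` have a positive definite solution. -/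
theorem isEquivalentToDoublyStochastic_iff [Nonempty ι] [Nonempty κ]
    {T : Matrix ι ι ℂ →ₗ[ℂ] Matrix κ κ ℂ} (hT : IsPositive T) :
    IsEquivalentToDoublyStochastic T ↔
      ∃ (P : Matrix ι ι ℂ) (Q : Matrix κ κ ℂ), P.PosDef ∧ Q.PosDef ∧ T P * Q = 1 ∧
        adjoint T Q * P = ((Fintype.card κ : ℂ) / Fintype.card ι) • (1 : Matrix ι ι ℂ) := by
  obtain ⟨a, ha⟩ : ∃ a : ℝ, a = √(Fintype.card ι : ℝ) := ⟨_, rfl⟩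
  obtain ⟨b, hb⟩ : ∃ b : ℝ, b = √(Fintype.card κ : ℝ) := ⟨_, rfl⟩
  have ha0 : 0 < a := ha ▸ Real.sqrt_pos.mpr (by exact_mod_cast Fintype.card_pos)
  have hb0 : 0 < b := hb ▸ Real.sqrt_pos.mpr (by exact_mod_cast Fintype.card_pos)
  have ha2 : (Fintype.card ι : ℂ) = (a : ℂ) * a := by
    rw [ha]; exact_mod_cast (Real.mul_self_sqrt (Nat.cast_nonneg _)).symm
  have hb2 : (Fintype.card κ : ℂ) = (b : ℂ) * b := by
    rw [hb]; exact_mod_cast (Real.mul_self_sqrt (Nat.cast_nonneg _)).symm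
  have hac : (a : ℂ) ≠ 0 := by exact_mod_cast ha0.ne'
  have hbc : (b : ℂ) ≠ 0 := by exact_mod_cast hb0.ne'
  simp only [IsEquivalentToDoublyStochastic, IsDoublyStochastic, ← ha, ← hb]
  rw [ha2, hb2]
  constructor
  · rintro ⟨S, ⟨-, h1, h2⟩, X', Y', hX', hY', hS⟩
    have hcd : (((b / a : ℝ) : ℂ)) = (b : ℂ) / a := by push_cast; rfl
    -- Double stochasticity says `S 1 = (a/b) 1`; the factor `b/a` in `Q` cancels this constant.
    refine ⟨X' * X'.conjTranspose, ((b : ℂ) / a) • (Y'.conjTranspose * Y'), ?_, ?_, ?_, ?_⟩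
    · exact Matrix.PosDef.mul_conjTranspose_self _ (Matrix.vecMul_injective_of_isUnit hX')
    · refine Matrix.PosDef.smul (Matrix.PosDef.conjTranspose_mul_self _
        (Matrix.mulVec_injective_of_isUnit hY')) ?_
      rw [← hcd]
      exact_mod_cast div_pos hb0 ha0
    · rw [map_smul, inv_smul_eq_iff₀ hac, hS, smul_smul] at h1
      rw [Matrix.mul_one] at h1
      have h3 : Y' * (T (X' * X'.conjTranspose) * ((b / a : ℂ) • Y'.conjTranspose)) = 1 := by
        rw [Matrix.mul_smul, Matrix.mul_smul, ← Matrix.mul_assoc, h1, smul_smul]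
        rw [show (b / a : ℂ) * (a * (b : ℂ)⁻¹) = 1 by field_simp, one_smul]
      -- One-sided inverses of square matrices are two-sided, so `Y'` can be moved cyclically to the
      -- right end.
      have h4 := mul_eq_one_comm.mp h3
      simpa [Matrix.mul_assoc] using h4
    · rw [map_smul, inv_smul_eq_iff₀ hbc, adjoint_conj hS, smul_smul] at h2
      rw [Matrix.mul_one] at h2
      have h3 : X'.conjTranspose * ((a / b : ℂ) • (adjoint T (Y'.conjTranspose * Y') * X')) = 1 := by
        rw [Matrix.mul_smul, ← Matrix.mul_assoc, h2, smul_smul]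
        rw [show (a / b : ℂ) * (b * (a : ℂ)⁻¹) = 1 by field_simp, one_smul]
      have h4 := mul_eq_one_comm.mp h3
      rw [Matrix.smul_mul] at h4
      rw [map_smul, Matrix.smul_mul, ← h4, smul_smul, Matrix.mul_assoc]
      congr 1
      field_simp
  · rintro ⟨P, Q, hP, hQ, h1, h2⟩
    obtain ⟨X', hX', rfl⟩ := exists_isUnit_mul_conjTranspose hP
    -- This inverts `Q = (b/a) Y'ᴴ Y'`: factor `(a/b) Q = Z Zᴴ` and take `Y' = Zᴴ`.
    have hcQ : (((a / b : ℝ) : ℂ) • Q).PosDef := by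
      refine hQ.smul ?_
      exact_mod_cast div_pos ha0 hb0
    obtain ⟨Z, hZ, hQZ⟩ := exists_isUnit_mul_conjTranspose hcQ
    have hcd : (((a / b : ℝ) : ℂ)) = (a : ℂ) / b := by push_cast; rfl
    rw [hcd] at hQZ
    have hS : ∃ S : Matrix ι ι ℂ →ₗ[ℂ] Matrix κ κ ℂ, ∀ X,
        S X = Z.conjTranspose * T (X' * X * X'.conjTranspose) * Z.conjTranspose.conjTranspose :=
      ⟨{ toFun := fun X =>
          Z.conjTranspose * T (X' * X * X'.conjTranspose) * Z.conjTranspose.conjTranspose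
         map_add' := fun X W => by simp [Matrix.mul_add, Matrix.add_mul]
         map_smul' := fun c X => by simp }, fun _ => rfl⟩
    obtain ⟨S, hS⟩ := hS
    refine ⟨S, ⟨?_, ?_, ?_⟩, X', Z.conjTranspose, hX', hZ.star, hS⟩
    · intro X hX
      rw [hS]
      exact (hT _ (hX.mul_mul_conjTranspose_same X')).mul_mul_conjTranspose_same _
    · rw [map_smul, inv_smul_eq_iff₀ hac, hS, smul_smul, Matrix.mul_one,
        Matrix.conjTranspose_conjTranspose]
      have h3 : (((b : ℂ) / a) • (T (X' * X'.conjTranspose) * Z)) * Z.conjTranspose = 1 := by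
        rw [Matrix.smul_mul, Matrix.mul_assoc, ← hQZ, Matrix.mul_smul, h1, smul_smul]
        rw [show (b / a : ℂ) * (a / b : ℂ) = 1 by field_simp, one_smul]
      have h4 := mul_eq_one_comm.mp h3
      rw [Matrix.mul_smul, ← Matrix.mul_assoc] at h4
      rw [← h4, smul_smul, show (a * (b : ℂ)⁻¹) * (b / a : ℂ) = 1 by field_simp, one_smul]
    · rw [map_smul, inv_smul_eq_iff₀ hbc, adjoint_conj hS, smul_smul, Matrix.mul_one,
        Matrix.conjTranspose_conjTranspose, ← hQZ, map_smul]
      have h3 : (((a : ℂ) * a / (b * b)) • (adjoint T Q * X')) * X'.conjTranspose = 1 := by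
        rw [Matrix.smul_mul, Matrix.mul_assoc, h2, smul_smul]
        rw [show ((a : ℂ) * a / (b * b)) * (b * b / (a * a)) = 1 by field_simp, one_smul]
      have h4 := mul_eq_one_comm.mp h3
      rw [← h4, Matrix.mul_smul, Matrix.mul_smul, Matrix.smul_mul, smul_smul, Matrix.mul_assoc]
      congr 1
      field_simp

/-- The adjoint of `T̃` is `W ↦ Id ⊗ T* (tr₂ W)`, with `tr₂` the partial trace over the second
tensor factor. -/
theorem adjoint_squareMap (T : Matrix ι ι ℂ →ₗ[ℂ] Matrix κ κ ℂ)
    (W : Matrix (κ × ι) (κ × ι) ℂ) :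
    adjoint (squareMap T) W = (1 : Matrix κ κ ℂ) ⊗ₖ
      adjoint T (∑ a : ι, W.submatrix (fun i => (i, a)) (fun i => (i, a))) := by
  refine adjoint_apply_eq_of_trace _ fun X => ?_
  have h1 : ∀ A : Matrix κ κ ℂ, ((A ⊗ₖ (1 : Matrix ι ι ℂ)) * W.conjTranspose).trace =
      (A * (∑ a : ι, W.submatrix (fun i => (i, a)) (fun i => (i, a))).conjTranspose).trace := by
    intro A
    simp only [Matrix.trace, Matrix.diag, Matrix.mul_apply, Fintype.sum_prod_type,
      Matrix.kronecker_apply, Matrix.one_apply, Matrix.conjTranspose_apply, Matrix.sum_apply,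
      Matrix.submatrix_apply, star_sum, Finset.mul_sum, mul_ite, mul_one, mul_zero, ite_mul,
      zero_mul, Finset.sum_ite_eq, Finset.mem_univ, if_true]
    refine Finset.sum_congr rfl fun i _ => Finset.sum_comm
  have h2 : ∀ B : Matrix ι ι ℂ, (X * ((1 : Matrix κ κ ℂ) ⊗ₖ B).conjTranspose).trace =
      ((∑ i : κ, X.submatrix (Prod.mk i) (Prod.mk i)) * B.conjTranspose).trace := by
    intro B
    rw [Finset.sum_mul, Matrix.trace_sum]
    simp only [Matrix.trace, Matrix.diag, Matrix.mul_apply, Fintype.sum_prod_type,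
      Matrix.kronecker_apply, Matrix.one_apply, Matrix.conjTranspose_apply,
      Matrix.submatrix_apply]
    refine Finset.sum_congr rfl fun i _ => Finset.sum_congr rfl fun a _ => ?_
    rw [Finset.sum_eq_single i (by intro j _ hj; simp [hj.symm]) (by simp)]
    simp
  rw [h2, ← trace_mul_adjoint, ← h1]
  rfl

theorem isEquivalentToDoublyStochastic_squareMap_iff [Nonempty ι] [Nonempty κ]
    {T : Matrix ι ι ℂ →ₗ[ℂ] Matrix κ κ ℂ} (hT : IsPositive T) :
    IsEquivalentToDoublyStochastic T ↔ IsEquivalentToDoublyStochastic (squareMap T) := by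
  rw [isEquivalentToDoublyStochastic_iff hT, isEquivalentToDoublyStochastic_iff hT.squareMap]
  have hk : (Fintype.card ι : ℂ) ≠ 0 := by exact_mod_cast Fintype.card_ne_zero
  have hm : (Fintype.card κ : ℂ) ≠ 0 := by exact_mod_cast Fintype.card_ne_zero
  have hkm : (Fintype.card (κ × ι) : ℂ) / Fintype.card (κ × ι) = 1 :=
    div_self (by exact_mod_cast Fintype.card_ne_zero)
  rw [hkm, one_smul]
  constructor
  · rintro ⟨P, Q, hP, hQ, h1, h2⟩
    have hc : 0 < ((Fintype.card κ : ℂ))⁻¹ := by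
      have : (0 : ℝ) < (Fintype.card κ : ℝ)⁻¹ := inv_pos.mpr (by exact_mod_cast Fintype.card_pos)
      have h : (0 : ℂ) < (((Fintype.card κ : ℝ)⁻¹ : ℝ) : ℂ) := by exact_mod_cast this
      simpa using h
    -- The partial trace of `1 ⊗ P` is `m P`, which `m⁻¹` in the second witness offsets; in the
    -- adjoint equation the partial trace contributes `k`, and `k · m⁻¹ · (m/k) = 1`.
    refine ⟨(1 : Matrix κ κ ℂ) ⊗ₖ P, ((Fintype.card κ : ℂ)⁻¹ • Q) ⊗ₖ (1 : Matrix ι ι ℂ),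
      Matrix.PosDef.one.kronecker hP, (hQ.smul hc).kronecker Matrix.PosDef.one, ?_, ?_⟩
    · have h3 : ∀ i : κ,
          ((1 : Matrix κ κ ℂ) ⊗ₖ P).submatrix (Prod.mk i) (Prod.mk i) = P := by
        intro i; ext a b; simp
      simp only [squareMap, LinearMap.coe_mk, AddHom.coe_mk, h3]
      rw [← Matrix.mul_kronecker_mul, Finset.sum_const, Finset.card_univ, map_nsmul,
        ← Nat.cast_smul_eq_nsmul ℂ, Matrix.smul_mul, Matrix.mul_smul, h1, smul_smul,
        mul_inv_cancel₀ hm, one_smul, Matrix.mul_one, Matrix.one_kronecker_one]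
    · have h3 : ∀ a : ι, (((Fintype.card κ : ℂ)⁻¹ • Q) ⊗ₖ (1 : Matrix ι ι ℂ)).submatrix
          (fun i => (i, a)) (fun i => (i, a)) = (Fintype.card κ : ℂ)⁻¹ • Q := by
        intro a; ext i j; simp
      simp only [adjoint_squareMap, h3]
      rw [← Matrix.mul_kronecker_mul, Finset.sum_const, Finset.card_univ, map_nsmul, map_smul,
        ← Nat.cast_smul_eq_nsmul ℂ, Matrix.smul_mul, Matrix.smul_mul, h2, smul_smul, smul_smul,
        show (Fintype.card ι : ℂ) * (Fintype.card κ : ℂ)⁻¹ *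
          ((Fintype.card κ : ℂ) / Fintype.card ι) = 1 by field_simp,
        one_smul, Matrix.mul_one, Matrix.one_kronecker_one]
  · rintro ⟨P, Q, hP, hQ, h1, h2⟩
    rw [adjoint_squareMap] at h2
    set R : Matrix ι ι ℂ := ∑ i : κ, P.submatrix (Prod.mk i) (Prod.mk i) with hR
    have hR0 : R.PosDef :=
      Matrix.posDef_sum Finset.univ_nonempty fun i _ => hP.submatrix (Prod.mk_right_injective i)
    have h1' : ∀ a : ι, T R * Q.submatrix (fun i => (i, a)) (fun i => (i, a)) = 1 := by
      intro a
      rw [← submatrix_kronecker_one_mul]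
      change (squareMap T P * Q).submatrix _ _ = 1
      rw [h1]
      exact Matrix.submatrix_one _ fun i j h => (Prod.mk.inj h).1
    obtain ⟨a₀⟩ := ‹Nonempty ι›
    -- Every compression of `Q` to a fixed second index is the inverse of `T R`, so all of them
    -- coincide.
    have hQa : ∀ a : ι, Q.submatrix (fun i => (i, a)) (fun i => (i, a)) =
        Q.submatrix (fun i => (i, a₀)) (fun i => (i, a₀)) := fun a =>
      left_inv_eq_right_inv (mul_eq_one_comm.mp (h1' a)) (h1' a₀)
    refine ⟨R, Q.submatrix (fun i => (i, a₀)) (fun i => (i, a₀)), hR0,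
      hQ.submatrix fun i j h => (Prod.mk.inj h).1, h1' a₀, ?_⟩
    simp only [hQa, Finset.sum_const, Finset.card_univ, map_nsmul] at h2
    have h3 : ∀ i : κ, (Fintype.card ι • adjoint T (Q.submatrix (fun i => (i, a₀))
        (fun i => (i, a₀)))) * P.submatrix (Prod.mk i) (Prod.mk i) = 1 := by
      intro i
      rw [← submatrix_one_kronecker_mul, h2]
      exact Matrix.submatrix_one _ (Prod.mk_right_injective i)
    -- Summing over the `m` diagonal blocks of `P` rebuilds `R`: `k T*(Q₀) R = m 1`, with `Q₀` the
    -- common compression.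
    have h4 := Finset.sum_congr (rfl : (Finset.univ : Finset κ) = Finset.univ) fun i _ => h3 i
    rw [← Finset.mul_sum, ← hR, Finset.sum_const, Finset.card_univ,
      ← Nat.cast_smul_eq_nsmul ℂ, ← Nat.cast_smul_eq_nsmul ℂ, Matrix.smul_mul] at h4
    rw [div_eq_inv_mul, mul_smul, ← h4, smul_smul, inv_mul_cancel₀ hk, one_smul]

end

end PositiveMap

theorem corollary3p7 (k m : ℕ) (hk : 0 < k) (hm : 0 < m)
    (T : Matrix (Fin k) (Fin k) ℂ →ₗ[ℂ] Matrix (Fin m) (Fin m) ℂ)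
    (hT : PositiveMap.IsPositive T) :
    PositiveMap.IsEquivalentToDoublyStochastic T ↔
      PositiveMap.IsEquivalentToDoublyStochastic (PositiveMap.squareMap T) := by
  have : NeZero k := ⟨hk.ne'⟩
  have : NeZero m := ⟨hm.ne'⟩
  exact PositiveMap.isEquivalentToDoublyStochastic_squareMap_iff hT
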